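/- For $\sigma=\sigma_1\cdots\sigma_n\in S_n$ let $\mathrm{des}(\sigma)=|\{i:\sigma_i>\sigma_{i+1}\}|$ and $\mathrm{inv}(\sigma)=|\{(i,j): i<j,\ \sigma_i>\sigma_j\}|$. For $\tau\in S_p$, a $\tau$-match in $\sigma$ is a position $i$ with $1\le i\le n-p+1$ such that $\sigma_i\sigma_{i+1}\cdots\sigma_{i+p-1}$ has reduction $\tau$ (the reduction replaces the $k$-th smallest letter by $k$ for each $k$). Let $\mathcal{NM}_n(\tau)$ be the set of $\sigma\in S_n$ without $\tau$-matches. For $p\ge 3$, $\tau\in S_p$ is called minimal overlapping if the smallest $i$ for which some $\sigma\in S_i$ has exactly two $\tau$-matches is $i=2p-1$. Let $[n]_q=1+q+\cdots+q^{n-1}$, $[n]_q!=[1]_q\cdots[n]_q$, and $\binom{n}{k}_q=\frac{[n]_q!}{[k]_q!\,[n-k]_q!}$ for $0\le k\le n$, and $\binom{n}{k}_q=0$ for $k>n$ (also when $n<0$). With $q,z$ indeterminates, define the formal power series in $t$ over $\mathbb{Q}(q,z)$ $$\mathrm{INM}_\tau(t,q,z)=1+\sum_{n\ge1}\frac{t^n}{[n]_q!}\sum_{\sigma\in\mathcal{NM}_n(\tau)}z^{\mathrm{des}(\sigma)+1}q^{\mathrm{inv}(\sigma)}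 .$$ **Theorem.** Let $\tau=\tau_1\cdots\tau_p\in S_p$ be minimal overlapping with $\tau_1=1$ and $\tau_p=s$, where $2\le s<p$. Then $$\mathrm{INM}_\tau(t,q,z)=\frac{1}{\mathrm{IU}_\tau(t,q,z)},\qquad \mathrm{IU}_\tau(t,q,z)=1+\sum_{n\ge1}\mathrm{IU}_{\tau,n}(q,z)\frac{t^n}{[n]_q!},$$ where $\mathrm{IU}_{\tau,1}(q,z)=-z$ and, for all $n\ge2$, $$\mathrm{IU}_{\tau,n}(q,z)=(1-z)\,\mathrm{IU}_{\tau,n-1}(q,z)-z^{\mathrm{des}(\tau)}q^{\mathrm{inv}(\tau)}\binom{n-s}{p-s}_q\mathrm{IU}_{\tau,n-p+1}(q,z),$$ the last term being $0$ for $n<p$. -/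

import Mathlib

/-!
A permutation `σ₁ ⋯ σₙ` of `{1, …, n}` is modelled by `σ : Equiv.Perm (Fin n)`; positions and
values are both shifted down by one, so that `σ_{i+1} = (σ i : ℕ) + 1`.
-/

namespace MinOverlap

/-- The descent number `des σ = #{i : σ_i > σ_{i+1}}`. -/
def des {n : ℕ} (σ : Equiv.Perm (Fin n)) : ℕ :=
  (Finset.univ.filter fun i : Fin n => ∃ h : (i : ℕ) + 1 < n, σ ⟨(i : ℕ) + 1, h⟩ < σ i).card

/-- The inversion number `inv σ = #{(i, j) : i < j, σ_i > σ_j}`. -/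
def inv {n : ℕ} (σ : Equiv.Perm (Fin n)) : ℕ :=
  (Finset.univ.filter fun x : Fin n × Fin n => x.1 < x.2 ∧ σ x.2 < σ x.1).card

/-- The reduction of a word with distinct letters: the `i`-th smallest letter is replaced by `i`
(counted from `0`), i.e. each letter is replaced by the number of smaller letters. -/
def red {p : ℕ} (w : Fin p → ℕ) : Fin p → ℕ :=
  fun a => (Finset.univ.filter fun b : Fin p => w b < w a).card

/-- There is a `τ`-match in `σ` starting at the (0-based) position `i`: the `p` consecutive letters
of `σ` starting there exist and their reduction is `τ`. -/
def IsMatchAt {p n : ℕ} (τ : Equiv.Perm (Fin p)) (σ : Equiv.Perm (Fin n)) (i : ℕ) : Prop :=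
  ∃ h : i + p ≤ n,
    ∀ a : Fin p, red (fun b : Fin p => (σ ⟨i + (b : ℕ), by omega⟩ : ℕ)) a = (τ a : ℕ)

instance {p n : ℕ} (τ : Equiv.Perm (Fin p)) (σ : Equiv.Perm (Fin n)) (i : ℕ) :
    Decidable (IsMatchAt τ σ i) := by
  unfold IsMatchAt; infer_instance

/-- `τ-mch(σ)`, the number of `τ`-matches in `σ`. -/
def mch {p n : ℕ} (τ : Equiv.Perm (Fin p)) (σ : Equiv.Perm (Fin n)) : ℕ :=
  ((Finset.range (n + 1)).filter fun i => IsMatchAt τ σ i).card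

/-- `τ ∈ S_p`, `p ≥ 3`, is minimal overlapping if the smallest `i` such that some `σ ∈ S_i` has
exactly two `τ`-matches is `2p - 1`. -/
def IsMinimalOverlapping {p : ℕ} (τ : Equiv.Perm (Fin p)) : Prop :=
  3 ≤ p ∧ IsLeast {i : ℕ | ∃ σ : Equiv.Perm (Fin i), mch τ σ = 2} (2 * p - 1)

/-- `NM_n(τ)`: the permutations of length `n` without `τ`-matches. -/
def NM {p : ℕ} (τ : Equiv.Perm (Fin p)) (n : ℕ) : Finset (Equiv.Perm (Fin n)) :=
  Finset.univ.filter fun σ => ∀ i : ℕ, i ≤ n → ¬ IsMatchAt τ σ i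

/-- The field `ℚ(q, z)` of rational functions in two indeterminates. -/
abbrev K : Type := FractionRing (MvPolynomial (Fin 2) ℚ)

/-- The indeterminate `q`. -/
noncomputable def q : K := algebraMap (MvPolynomial (Fin 2) ℚ) K (MvPolynomial.X 0)

/-- The indeterminate `z`. -/
noncomputable def z : K := algebraMap (MvPolynomial (Fin 2) ℚ) K (MvPolynomial.X 1)

/-- `[n]_q = 1 + q + ⋯ + q^{n-1}`. -/
noncomputable def qInt (n : ℕ) : K := ∑ i ∈ Finset.range n, q ^ i

/-- `[n]_q! = [1]_q [2]_q ⋯ [n]_q`. -/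
noncomputable def qFactorial (n : ℕ) : K := ∏ i ∈ Finset.range n, qInt (i + 1)

/-- The `q`-binomial coefficient `[n]_q! / ([k]_q! [n-k]_q!)`, which is `0` for `k > n`. -/
noncomputable def qBinom (n k : ℕ) : K :=
  if k ≤ n then qFactorial n / (qFactorial k * qFactorial (n - k)) else 0

/-- `INM_{τ,n}(q,z) = ∑_{σ ∈ NM_n(τ)} z^{des σ + 1} q^{inv σ}`. -/
noncomputable def INMcoeff {p : ℕ} (τ : Equiv.Perm (Fin p)) (n : ℕ) : K :=
  ∑ σ ∈ NM τ n, z ^ (des σ + 1) * q ^ inv σ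

/-- `INM_τ(t,q,z) = 1 + ∑_{n ≥ 1} INM_{τ,n}(q,z) tⁿ / [n]_q!`, a power series in `t`. -/
noncomputable def INM {p : ℕ} (τ : Equiv.Perm (Fin p)) : PowerSeries K :=
  PowerSeries.mk fun n => if n = 0 then 1 else INMcoeff τ n / qFactorial n

/-- `IU_τ(t,q,z) = 1 / INM_τ(t,q,z)`; the constant term of `INM_τ` is `1`, so this is a genuine
multiplicative inverse. -/
noncomputable def IU {p : ℕ} (τ : Equiv.Perm (Fin p)) : PowerSeries K := (INM τ)⁻¹

/-- `IU_{τ,n}(q,z)`, the coefficient of `tⁿ / [n]_q!` in `IU_τ(t,q,z)`. -/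
noncomputable def IUcoeff {p : ℕ} (τ : Equiv.Perm (Fin p)) (n : ℕ) : K :=
  qFactorial n * PowerSeries.coeff n (IU τ)

end MinOverlap

/-!
The inverse of `INM_τ` is found combinatorially. A chain covers a word by ascents and occurrences of
`τ`, consecutive links sharing one letter; it has a sign, and `chainWeight` sums the chains covering
a given word. Because two occurrences of `τ` share at most one letter, the convolution of
`chainWeight` with the weight of the `τ`-avoiding words telescopes along the first letter, and the
`q`-exponential generating function, which turns this convolution into a product, shows that
`IU_τ = 1 + ∑ₙ tⁿ / [n]_q! ∑_w q ^ inv w * chainWeight w`.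

As `τ` begins with its smallest letter, a covered word begins with its smallest letter as well, from
which the recursion is read off at the first link. If that link is an ascent, deleting the first
letter leaves an arbitrary covered word. If it is an occurrence of `τ`, the rest of the word must
start with its minimum `l`, the last letter of the occurrence; having `s - 1` smaller letters in
the occurrence, `l` must be the `s`-th smallest letter overall, so the occurrence contains the `s`
smallest letters and only its other `p - s` letters, among the `n - s` remaining ones, can be
chosen freely.
-/

namespace MinOverlap

open Finset

section Arrangements

variable {α : Type*}

/-- The arrangements of a finite set `S`: the words in which every element of `S` occurs exactly
once. -/
def arrangements (S : Finset α) : Finset (List α) := ⟨S.val.lists, Multiset.lists_nodup_finset S⟩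

theorem mem_arrangements {S : Finset α} {w : List α} :
    w ∈ arrangements S ↔ (w : Multiset α) = S.val :=
  (Multiset.mem_lists_iff _ _).trans eq_comm

theorem nodup_of_mem_arrangements {S : Finset α} {w : List α} (hw : w ∈ arrangements S) :
    w.Nodup :=
  Multiset.coe_nodup.1 (mem_arrangements.1 hw ▸ S.nodup)

theorem length_of_mem_arrangements {S : Finset α} {w : List α} (hw : w ∈ arrangements S) :
    w.length = #S :=
  congrArg Multiset.card (mem_arrangements.1 hw)

theorem mem_iff_of_mem_arrangements {S : Finset α} {w : List α} (hw : w ∈ arrangements S) {x : α} :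
    x ∈ w ↔ x ∈ S := by
  rw [← Multiset.mem_coe, mem_arrangements.1 hw, Finset.mem_val]

theorem mem_arrangements_toFinset [DecidableEq α] {w : List α} (hw : w.Nodup) :
    w ∈ arrangements w.toFinset :=
  mem_arrangements.2 (List.toFinset_val w ▸ congrArg _ hw.dedup.symm)

theorem card_arrangements (S : Finset α) : #(arrangements S) = (#S).factorial := by
  change S.val.lists.card = S.val.card.factorial
  induction S.val using Quotient.inductionOn with
  | h w => exact List.length_permutations w

@[simp]
theorem arrangements_empty : arrangements (∅ : Finset α) = {[]} := by
  ext w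
  simp [mem_arrangements]

@[simp]
theorem arrangements_singleton (x : α) : arrangements {x} = {[x]} := by
  ext w
  simp [mem_arrangements]

theorem injOn_map_arrangements {β : Type*} {S : Finset α} {φ : α → β} (hφ : Set.InjOn φ S) :
    Set.InjOn (List.map φ) (arrangements S) := by
  intro u hu v hv huv
  refine List.ext_getElem (by simpa using congrArg List.length huv) fun i hi hi' => ?_
  have hφi := List.getElem_of_eq huv (i := i) (by rwa [List.length_map])
  rw [List.getElem_map, List.getElem_map] at hφi
  exact hφ ((mem_iff_of_mem_arrangements hu).1 (List.getElem_mem hi))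
    ((mem_iff_of_mem_arrangements hv).1 (List.getElem_mem hi')) hφi

theorem arrangements_image {β : Type*} [DecidableEq β] {S : Finset α} {φ : α → β}
    (hφ : Set.InjOn φ S) :
    arrangements (S.image φ) = (arrangements S).image (List.map φ) := by
  refine (eq_of_subset_of_card_le (image_subset_iff.2 fun w hw => ?_) ?_).symm
  · rw [mem_arrangements] at hw ⊢
    rw [image_val_of_injOn hφ, ← hw, Multiset.map_coe]
  · rw [card_arrangements, card_image_of_injOn hφ,
      card_image_of_injOn (injOn_map_arrangements hφ), card_arrangements]

theorem sum_arrangements_split [DecidableEq α] {M : Type*} [AddCommMonoid M] {S : Finset α}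
    {k : ℕ} (hk : k ≤ #S) (G : List α → List α → M) :
    ∑ w ∈ arrangements S, G (w.take k) (w.drop k) =
      ∑ C ∈ powersetCard k S, ∑ x ∈ arrangements C, ∑ y ∈ arrangements (S \ C), G x y := by
  simp_rw [Finset.sum_sigma']
  refine Finset.sum_bij' (fun w _ => ⟨(w.take k).toFinset, w.take k, w.drop k⟩)
    (fun t _ => t.2.1 ++ t.2.2) (fun w hw => ?_) ?_ (fun w _ => w.take_append_drop k) ?_
    (fun _ _ => rfl)
  · have hnodup : (w.take k ++ w.drop k).Nodup :=
      (w.take_append_drop k).symm ▸ nodup_of_mem_arrangements hw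
    have htake := mem_arrangements_toFinset hnodup.of_append_left
    have hsplit : S.val = ↑(w.take k) + ↑(w.drop k) := by
      rw [Multiset.coe_add, List.take_append_drop, mem_arrangements.1 hw]
    simp only [mem_sigma, mem_powersetCard]
    refine ⟨⟨?_, ?_⟩, htake, ?_⟩
    · rw [← val_le_iff, ← mem_arrangements.1 htake, hsplit]
      exact Multiset.le_add_right _ _
    · rw [← length_of_mem_arrangements htake, List.length_take, length_of_mem_arrangements hw,
        min_eq_left hk]
    · rw [mem_arrangements, sdiff_val, ← mem_arrangements.1 htake, hsplit, add_tsub_cancel_left]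
  · rintro ⟨C, x, y⟩ h
    simp only [mem_sigma, mem_powersetCard] at h
    obtain ⟨⟨hCS, -⟩, hx, hy⟩ := h
    rw [mem_arrangements] at hx hy ⊢
    rw [← Multiset.coe_add, hx, hy, sdiff_val, add_tsub_cancel_of_le (val_le_iff.2 hCS)]
  · rintro ⟨C, x, y⟩ h
    simp only [mem_sigma, mem_powersetCard] at h
    obtain ⟨⟨-, rfl⟩, hx, -⟩ := h
    have hxC : x.toFinset = C := by
      ext a
      rw [List.mem_toFinset, mem_iff_of_mem_arrangements hx]
    rw [← length_of_mem_arrangements hx, List.take_left, List.drop_left, hxC]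

end Arrangements

section Inversions

variable {α : Type*} [LinearOrder α]

/-- The number of inversions of a word. -/
def wordInv : List α → ℕ
  | [] => 0
  | x :: w => w.countP (· < x) + wordInv w

/-- The number of elements of `S` below `x`; on `S` this is the increasing bijection onto
`range #S`. -/
def rank (S : Finset α) (x : α) : ℕ := #{y ∈ S | y < x}

/-- The number of inversions between a letter of `C` and a later letter of `D`. -/
def crossInv (C D : Finset α) : ℕ := ∑ c ∈ C, rank D c

theorem countP_lt_of_mem_arrangements {S : Finset α} {w : List α} (hw : w ∈ arrangements S)
    (x : α) : w.countP (· < x) = rank S x := by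
  rw [rank, card_def, filter_val, ← Multiset.countP_eq_card_filter, ← mem_arrangements.1 hw,
    Multiset.coe_countP]

theorem strictMonoOn_rank (S : Finset α) : StrictMonoOn (rank S) S := fun x hx _ _ hxy =>
  card_lt_card <| (ssubset_iff_of_subset
    (monotone_filter_right S fun _ _ ha => ha.trans hxy)).2
      ⟨x, mem_filter.2 ⟨hx, hxy⟩, fun h => lt_irrefl x (mem_filter.1 h).2⟩

theorem image_rank (S : Finset α) : S.image (rank S) = range #S := by
  refine eq_of_subset_of_card_le (image_subset_iff.2 fun x hx => mem_range.2 ?_) ?_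
  · exact card_lt_card (filter_ssubset.2 ⟨x, hx, lt_irrefl x⟩)
  · rw [card_image_of_injOn (strictMonoOn_rank S).injOn, card_range]

theorem rank_range {n x : ℕ} (hx : x ≤ n) : rank (range n) x = x := by
  have hfilter : {y ∈ range n | y < x} = range x := by
    ext y
    simp only [mem_filter, mem_range]
    omega
  rw [rank, hfilter, card_range]

theorem wordInv_append {C D : Finset α} {x y : List α} (hx : x ∈ arrangements C)
    (hy : y ∈ arrangements D) : wordInv (x ++ y) = crossInv C D + wordInv x + wordInv y := by
  have hsum : crossInv C D = (x.map (rank D)).sum := by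
    rw [crossInv, sum_eq_multiset_sum, ← mem_arrangements.1 hx, Multiset.map_coe,
      Multiset.sum_coe]
  rw [hsum]
  clear hx hsum
  induction x with
  | nil => simp [wordInv]
  | cons a x ih =>
    rw [List.cons_append, wordInv, wordInv, ih, List.countP_append,
      countP_lt_of_mem_arrangements hy, List.map_cons, List.sum_cons]
    ring

end Inversions

section InversionSum

variable {α R : Type*} [LinearOrder α] [CommRing R] (q : R)

/-- The generating function `∑ q ^ inv w * f w` over the arrangements `w` of `S`. -/
def invSum (S : Finset α) (f : List α → R) : R := ∑ w ∈ arrangements S, q ^ wordInv w * f w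

variable {q}

theorem invSum_congr {S : Finset α} {f g : List α → R} (h : ∀ w ∈ arrangements S, f w = g w) :
    invSum q S f = invSum q S g :=
  sum_congr rfl fun w hw => by rw [h w hw]

theorem invSum_eq_zero {S : Finset α} {f : List α → R} (h : ∀ w ∈ arrangements S, f w = 0) :
    invSum q S f = 0 :=
  sum_eq_zero fun w hw => by rw [h w hw, mul_zero]

theorem invSum_const_mul (S : Finset α) (c : R) (f : List α → R) :
    invSum q S (fun w => c * f w) = c * invSum q S f := by
  simp only [invSum, mul_sum, mul_left_comm]

theorem invSum_mul_const (S : Finset α) (f : List α → R) (c : R) :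
    invSum q S (fun w => f w * c) = invSum q S f * c := by
  simp only [invSum, sum_mul, mul_assoc]

theorem invSum_sub (S : Finset α) (f g : List α → R) :
    invSum q S (fun w => f w - g w) = invSum q S f - invSum q S g := by
  simp only [invSum, mul_sub, sum_sub_distrib]

theorem invSum_split {S : Finset α} {k : ℕ} (hk : k ≤ #S) (G : List α → List α → R) :
    invSum q S (fun w => G (w.take k) (w.drop k)) =
      ∑ C ∈ powersetCard k S, q ^ crossInv C (S \ C) *
        invSum q C (fun x => invSum q (S \ C) (G x)) := by
  have hsplit := sum_arrangements_split hk fun x y => q ^ wordInv (x ++ y) * G x y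
  simp only [List.take_append_drop] at hsplit
  rw [invSum, hsplit]
  refine sum_congr rfl fun C _ => ?_
  simp only [invSum, mul_sum]
  refine sum_congr rfl fun x hx => sum_congr rfl fun y hy => ?_
  rw [wordInv_append hx hy]
  ring

theorem invSum_empty (f : List α → R) : invSum q ∅ f = f [] := by
  simp [invSum, wordInv]

theorem invSum_singleton (x : α) (f : List α → R) : invSum q {x} f = f [x] := by
  simp [invSum, wordInv]

theorem invSum_eq_sum_cons {S : Finset α} (hS : S.Nonempty) (f : List α → R) :
    invSum q S f = ∑ x ∈ S, q ^ rank S x * invSum q (S.erase x) (fun y => f (x :: y)) := by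
  have hsplit := invSum_split (q := q) hS.card_pos fun x y => f (x ++ y)
  simp only [List.take_append_drop] at hsplit
  rw [hsplit, powersetCard_one, sum_map]
  refine sum_congr rfl fun x _ => ?_
  have hrank : crossInv {x} (S.erase x) = rank S x := by
    rw [crossInv, sum_singleton, rank, rank, filter_erase, erase_eq_of_notMem (by simp)]
  simp only [Function.Embedding.coeFn_mk, sdiff_singleton_eq_erase, invSum_singleton, hrank,
    List.singleton_append]

end InversionSum

section OrderInvariance

variable {M R : Type*} [CommRing R] {q : R} {S : Finset ℕ} {w : List ℕ} {φ : ℕ → ℕ}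

/-- A function of words is order invariant if it does not change when the letters of a word are
relabelled increasingly. -/
def OrderInvariant (f : List ℕ → M) : Prop :=
  ∀ ⦃w : List ℕ⦄ ⦃φ : ℕ → ℕ⦄, StrictMonoOn φ {x | x ∈ w} → f (w.map φ) = f w

/-- The reduction of a word: each letter is replaced by the number of smaller letters. -/
def reduction (w : List ℕ) : List ℕ := w.map fun x => w.countP (· < x)

theorem countP_lt_map {s : Set ℕ} (hφ : StrictMonoOn φ s) (hw : ∀ y ∈ w, y ∈ s) {x : ℕ}
    (hx : x ∈ s) : (w.map φ).countP (· < φ x) = w.countP (· < x) := by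
  rw [List.countP_map]
  exact List.countP_congr fun y hy => by simpa using hφ.lt_iff_lt (hw y hy) hx

theorem orderInvariant_reduction : OrderInvariant reduction := fun w φ hφ => by
  rw [reduction, reduction, List.map_map]
  exact List.map_congr_left fun x hx => countP_lt_map hφ (fun _ hy => hy) hx

theorem orderInvariant_wordInv : OrderInvariant (wordInv (α := ℕ)) := by
  intro w φ hφ
  induction w with
  | nil => rfl
  | cons c w ih =>
    rw [List.map_cons, wordInv, wordInv, ih (hφ.mono fun _ => List.mem_cons_of_mem c),
      countP_lt_map hφ (fun _ => List.mem_cons_of_mem c) List.mem_cons_self]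

theorem reduction_eq_map_rank (hw : w ∈ arrangements S) : reduction w = w.map (rank S) :=
  List.map_congr_left fun x _ => countP_lt_of_mem_arrangements hw x

theorem OrderInvariant.apply_reduction {f : List ℕ → M} (hf : OrderInvariant f)
    (hw : w ∈ arrangements S) : f (reduction w) = f w := by
  rw [reduction_eq_map_rank hw]
  exact hf ((strictMonoOn_rank S).mono fun _ => (mem_iff_of_mem_arrangements hw).1)

theorem reduction_mem_arrangements (hw : w ∈ arrangements S) :
    reduction w ∈ arrangements (range #S) := by
  rw [← image_rank, arrangements_image (strictMonoOn_rank S).injOn, reduction_eq_map_rank hw]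
  exact mem_image_of_mem _ hw

theorem reduction_of_mem_arrangements_range {n : ℕ} (hw : w ∈ arrangements (range n)) :
    reduction w = w := by
  rw [reduction_eq_map_rank hw]
  exact (List.map_congr_left fun x hx => rank_range <| le_of_lt <| mem_range.1 <|
    (mem_iff_of_mem_arrangements hw).1 hx).trans (List.map_id' w)

theorem invSum_image (hφ : StrictMonoOn φ S) {f : List ℕ → R} (hf : OrderInvariant f) :
    invSum q (S.image φ) f = invSum q S f := by
  rw [invSum, arrangements_image hφ.injOn, sum_image (injOn_map_arrangements hφ.injOn)]
  refine sum_congr rfl fun w hw => ?_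
  have hφw : StrictMonoOn φ {x | x ∈ w} := hφ.mono fun _ => (mem_iff_of_mem_arrangements hw).1
  rw [orderInvariant_wordInv hφw, hf hφw]

theorem invSum_eq_invSum_range (S : Finset ℕ) {f : List ℕ → R} (hf : OrderInvariant f) :
    invSum q S f = invSum q (range #S) f := by
  rw [← image_rank, invSum_image (strictMonoOn_rank S) hf]

end OrderInvariance

section Descents

/-- The number of descents of a word. -/
def wordDes {α : Type*} [LinearOrder α] : List α → ℕ
  | c :: d :: w => (if d < c then 1 else 0) + wordDes (d :: w)
  | _ => 0

theorem wordDes_eq_take_add_drop {α : Type*} [LinearOrder α] {w : List α} {k : ℕ}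
    (hk : k < w.length) : wordDes w = wordDes (w.take (k + 1)) + wordDes (w.drop k) := by
  induction k generalizing w with
  | zero => cases w <;> simp [wordDes]
  | succ k ih =>
    obtain _ | ⟨c, _ | ⟨d, w⟩⟩ := w
    · simp [wordDes]
    · simp at hk
    · have htail := ih (w := d :: w) (by simpa using hk)
      simp only [List.take_succ_cons, List.drop_succ_cons, wordDes] at htail ⊢
      rw [htail, add_assoc]

theorem orderInvariant_wordDes : OrderInvariant (wordDes (α := ℕ)) := by
  intro w φ hφ
  induction w with
  | nil => rfl
  | cons c w ih =>
    cases w with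
    | nil => rfl
    | cons d w =>
      have htail := ih (hφ.mono fun _ => List.mem_cons_of_mem c)
      rw [List.map_cons] at htail
      simp only [List.map_cons, wordDes, htail,
        hφ.lt_iff_lt (List.mem_cons_of_mem c List.mem_cons_self) List.mem_cons_self]

end Descents

section Patterns

variable {t w : List ℕ} {c : ℕ}

/-- The word `w` starts with an occurrence of the pattern `t`: its first `t.length` letters have
reduction `t`. -/
def HeadMatch (t w : List ℕ) : Prop := reduction (w.take t.length) = t

instance (t w : List ℕ) : Decidable (HeadMatch t w) :=
  inferInstanceAs (Decidable (reduction (w.take t.length) = t))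

/-- The pattern `t` occurs in `w` at consecutive positions. -/
def HasMatch (t w : List ℕ) : Prop := ∃ i, HeadMatch t (w.drop i)

instance (t w : List ℕ) : Decidable (HasMatch t w) :=
  decidable_of_iff (∃ v ∈ w.tails, HeadMatch t v)
    ⟨fun ⟨v, hv, h⟩ => ⟨w.length - v.length, by
      rwa [← List.suffix_iff_eq_drop.1 ((List.mem_tails v w).1 hv)]⟩,
      fun ⟨i, h⟩ => ⟨w.drop i, (List.mem_tails _ _).2 (List.drop_suffix i w), h⟩⟩

/-- Two occurrences of `t` in a word with distinct letters share at most one letter. -/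
def NonOverlapping (t : List ℕ) : Prop :=
  ∀ ⦃w : List ℕ⦄ ⦃d : ℕ⦄, w.Nodup → 0 < d → HeadMatch t w → HeadMatch t (w.drop d) →
    t.length ≤ d + 1

theorem length_reduction (w : List ℕ) : (reduction w).length = w.length := List.length_map _

theorem HeadMatch.length_le (h : HeadMatch t w) : t.length ≤ w.length := by
  have hlength := congrArg List.length h
  rw [length_reduction, List.length_take] at hlength
  exact min_eq_left_iff.1 hlength

theorem headMatch_take_iff {k : ℕ} : HeadMatch t (w.take k) ↔ t.length ≤ k ∧ HeadMatch t w := by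
  constructor
  · intro h
    have hk : t.length ≤ k := h.length_le.trans (List.length_take_le k w)
    rw [HeadMatch, List.take_take, min_eq_left hk] at h
    exact ⟨hk, h⟩
  · rintro ⟨hk, h⟩
    rwa [HeadMatch, List.take_take, min_eq_left hk]

theorem not_hasMatch_of_length_lt (hw : w.length < t.length) : ¬ HasMatch t w := fun ⟨_, h⟩ =>
  absurd (h.length_le.trans (List.drop_sublist _ _).length_le) hw.not_ge

theorem hasMatch_cons : HasMatch t (c :: w) ↔ HeadMatch t (c :: w) ∨ HasMatch t w := by
  constructor
  · rintro ⟨_ | i, h⟩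
    exacts [.inl h, .inr ⟨i, h⟩]
  · rintro (h | ⟨i, h⟩)
    exacts [⟨0, h⟩, ⟨i + 1, h⟩]

theorem HeadMatch.head_le (h : HeadMatch t (c :: w)) (h0 : t.head? = some 0) :
    ∀ x ∈ w.take (t.length - 1), c ≤ x := by
  obtain _ | ⟨a, t⟩ := t
  · simp at h0
  · rw [HeadMatch, List.length_cons, List.take_succ_cons, reduction, List.map_cons] at h
    have hcount := (List.cons.inj h).1.trans (Option.some.inj h0)
    intro x hx
    simpa using List.countP_eq_zero.1 hcount x (List.mem_cons_of_mem c hx)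

theorem orderInvariant_headMatch (t : List ℕ) : OrderInvariant (HeadMatch t) := fun w φ hφ => by
  rw [HeadMatch, ← List.map_take, orderInvariant_reduction (hφ.mono fun _ => List.mem_of_mem_take),
    HeadMatch]

theorem orderInvariant_hasMatch (t : List ℕ) : OrderInvariant (HasMatch t) := fun w φ hφ => by
  simp only [HasMatch, ← List.map_drop]
  exact congrArg Exists <| funext fun i =>
    orderInvariant_headMatch t (hφ.mono fun _ => List.mem_of_mem_drop)

end Patterns

section Convolution

variable {α R : Type*} [CommRing R]

/-- The convolution of two functions on words, over all factorisations of a word. -/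
def conv (f g : List α → R) (w : List α) : R :=
  ∑ k ∈ range (w.length + 1), f (w.take k) * g (w.drop k)

variable {f g : List α → R} {w : List α}

theorem conv_nil : conv f g [] = f [] * g [] := by simp [conv]

theorem conv_cons (c : α) :
    conv f g (c :: w) = f [] * g (c :: w) + conv (fun x => f (c :: x)) g w := by
  rw [conv, conv, List.length_cons, sum_range_succ', add_comm]
  simp only [List.take_succ_cons, List.drop_succ_cons, List.take_zero, List.drop_zero]

theorem conv_congr {f' : List α → R} (h : ∀ k, f (w.take k) = f' (w.take k)) :
    conv f g w = conv f' g w :=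
  sum_congr rfl fun k _ => by rw [h k]

theorem conv_indicator_nil (a : R) :
    conv (fun x => if x = [] then a else 0) g w = a * g w := by
  cases w <;> simp [conv]

theorem conv_drop (hf : f [] = 0) (m : ℕ) :
    conv (fun x => f (x.drop m)) g w = conv f g (w.drop m) := by
  induction m generalizing w with
  | zero => rfl
  | succ m ih =>
    cases w with
    | nil => simp [conv_nil]
    | cons c w => simp only [conv_cons, List.drop_nil, hf, zero_mul, zero_add,
        List.drop_succ_cons, ih]

theorem conv_add_mul_sub_mul {f₁ f₂ f₃ : List α → R} (a b : R) :
    conv (fun x => f₁ x + (a * f₂ x - b * f₃ x)) g w =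
      conv f₁ g w + (a * conv f₂ g w - b * conv f₃ g w) := by
  simp only [conv, add_mul, sub_mul, mul_assoc, sum_add_distrib, sum_sub_distrib, mul_sum]

end Convolution

section Weights

variable {R : Type*} [CommRing R] (z : R) (t : List ℕ)

/-- The weight `z ^ (des w + 1)` of a nonempty word `w` avoiding the pattern `t`, as in `INM_τ`. -/
def nmWeight (w : List ℕ) : R :=
  if w = [] then 1 else if HasMatch t w then 0 else z ^ (wordDes w + 1)

/-- The signed weight of the ways to cover a nonempty word by a chain of ascents and occurrences of
`t`, consecutive links sharing one letter: an ascent contributes `1 - z`, an occurrence of `t`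
contributes `-z ^ des t`, and the chain as a whole `-z`. -/
def chainWeight : List ℕ → R
  | [] => 0
  | [_] => -z
  | c :: d :: w =>
    (if c < d then 1 - z else 0) * chainWeight (d :: w) -
      (if HeadMatch t (c :: d :: w) then z ^ wordDes t else 0) *
        chainWeight ((d :: w).drop (t.length - 2))
  termination_by w => w.length

variable {z t} {c d : ℕ} {w : List ℕ}

theorem orderInvariant_nmWeight : OrderInvariant (nmWeight z t) := fun w φ hφ => by
  simp only [nmWeight, orderInvariant_hasMatch t hφ, orderInvariant_wordDes hφ,
    List.map_eq_nil_iff]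

theorem orderInvariant_chainWeight : OrderInvariant (chainWeight z t) := by
  intro w φ hφ
  induction w using chainWeight.induct t with
  | case1 => rfl
  | case2 c => simp [chainWeight]
  | case3 c d w ih ih' =>
    have htail : StrictMonoOn φ {x | x ∈ d :: w} := hφ.mono fun _ => List.mem_cons_of_mem c
    have hdrop := ih' (htail.mono fun _ => List.mem_of_mem_drop)
    have hmatch := orderInvariant_headMatch t hφ
    have hlt := hφ.lt_iff_lt List.mem_cons_self (List.mem_cons_of_mem c List.mem_cons_self)
    simp only [List.map_cons, List.map_drop] at ih hdrop hmatch ⊢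
    simp only [chainWeight, ih htail, hdrop, hmatch, hlt]

theorem HeadMatch.lt (h : HeadMatch t (c :: d :: w)) (h0 : t.head? = some 0) (ht : 2 ≤ t.length)
    (hcd : c ≠ d) : c < d := by
  refine lt_of_le_of_ne (h.head_le h0 d ?_) hcd
  rw [show t.length - 1 = t.length - 2 + 1 by omega, List.take_succ_cons]
  exact List.mem_cons_self

theorem HeadMatch.drop_ne_nil (h : HeadMatch t (c :: d :: w)) :
    (d :: w).drop (t.length - 2) ≠ [] := by
  have hlength := h.length_le
  simp only [List.length_cons] at hlength
  simp only [ne_eq, List.drop_eq_nil_iff, List.length_cons]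
  omega

theorem HeadMatch.wordDes_eq (h : HeadMatch t w) (ht : 1 ≤ t.length) (hw : w.Nodup) :
    wordDes w = wordDes t + wordDes (w.drop (t.length - 1)) := by
  have hprefix : wordDes t = wordDes (w.take t.length) := by
    conv_lhs => rw [← h]
    exact orderInvariant_wordDes.apply_reduction
      (mem_arrangements_toFinset (hw.sublist (List.take_sublist _ _)))
  have hlength := h.length_le
  rw [hprefix, wordDes_eq_take_add_drop (w := w) (k := t.length - 1) (by omega),
    Nat.sub_add_cancel ht]

theorem HeadMatch.hasMatch_iff (h : HeadMatch t (c :: w)) (ht : NonOverlapping t)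
    (hw : (c :: w).Nodup) : HasMatch t w ↔ HasMatch t (w.drop (t.length - 2)) := by
  refine ⟨?_, fun ⟨i, hi⟩ => ⟨t.length - 2 + i, by rwa [← List.drop_drop]⟩⟩
  rintro ⟨i, hi⟩
  have hlength : t.length ≤ i + 1 + 1 := ht hw i.succ_pos h hi
  refine ⟨i - (t.length - 2), ?_⟩
  rwa [List.drop_drop, Nat.add_sub_cancel' (by omega)]

theorem HeadMatch.nmWeight_eq_zero (h : HeadMatch t (c :: w)) : nmWeight z t (c :: w) = 0 := by
  simp [nmWeight, hasMatch_cons, h]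

theorem HeadMatch.nmWeight_tail (h : HeadMatch t (c :: d :: w)) (hno : NonOverlapping t)
    (h0 : t.head? = some 0) (ht : 2 ≤ t.length) (hw : (c :: d :: w).Nodup) :
    nmWeight z t (d :: w) = z ^ wordDes t * nmWeight z t ((d :: w).drop (t.length - 2)) := by
  have hcd : c < d := h.lt h0 ht (by simp_all)
  have hdes : wordDes (d :: w) = wordDes t + wordDes ((d :: w).drop (t.length - 2)) := by
    have hsplit := h.wordDes_eq (by omega) hw
    rwa [show t.length - 1 = t.length - 2 + 1 by omega, List.drop_succ_cons, wordDes,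
      if_neg hcd.not_gt, zero_add] at hsplit
  simp only [nmWeight, h.hasMatch_iff hno hw, hdes, h.drop_ne_nil, reduceCtorEq, if_false,
    mul_ite, mul_zero, pow_add, mul_assoc]

theorem nmWeight_cons_cons (hcd : c ≠ d) (h : ¬ HeadMatch t (c :: d :: w)) :
    nmWeight z t (c :: d :: w) = (if c < d then 1 else z) * nmWeight z t (d :: w) := by
  simp only [nmWeight, hasMatch_cons (c := c), h, false_or, wordDes, reduceCtorEq, if_false]
  rcases lt_or_gt_of_ne hcd with hlt | hlt
  · simp only [hlt, hlt.not_gt, if_true, if_false, zero_add, one_mul]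
  · simp only [hlt, hlt.not_gt, if_true, if_false, mul_ite, mul_zero]
    split_ifs <;> ring

theorem chainWeight_cons_take (ht : 2 ≤ t.length) (k : ℕ) :
    chainWeight z t (c :: (d :: w).take k) =
      (if (d :: w).take k = [] then -z else 0) +
        ((if c < d then 1 - z else 0) * chainWeight z t ((d :: w).take k) -
          (if HeadMatch t (c :: d :: w) then z ^ wordDes t else 0) *
            chainWeight z t (((d :: w).take k).drop (t.length - 2))) := by
  cases k with
  | zero => simp [chainWeight]
  | succ k =>
    have hmatch : HeadMatch t (c :: d :: w.take k) ↔
        t.length ≤ k + 2 ∧ HeadMatch t (c :: d :: w) := by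
      simpa only [List.take_succ_cons] using
        headMatch_take_iff (t := t) (w := c :: d :: w) (k := k + 2)
    have hshort : ¬ t.length ≤ k + 2 → (d :: w.take k).drop (t.length - 2) = [] := fun h => by
      rw [List.drop_eq_nil_iff, List.length_cons, List.length_take]
      omega
    by_cases hk : t.length ≤ k + 2
    · simp [chainWeight, hmatch, hk]
    · simp [chainWeight, hmatch, hk, hshort hk]

theorem conv_chainWeight_cons_cons (ht : 2 ≤ t.length) (g : List ℕ → R) :
    conv (chainWeight z t) g (c :: d :: w) =
      -z * g (d :: w) +
        ((if c < d then 1 - z else 0) * conv (chainWeight z t) g (d :: w) -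
          (if HeadMatch t (c :: d :: w) then z ^ wordDes t else 0) *
            conv (chainWeight z t) g ((d :: w).drop (t.length - 2))) := by
  have hnil : chainWeight z t [] = 0 := by rw [chainWeight]
  rw [← conv_drop hnil, ← conv_indicator_nil, ← conv_add_mul_sub_mul, conv_cons, hnil, zero_mul,
    zero_add]
  exact conv_congr (chainWeight_cons_take ht)

theorem conv_chainWeight_nmWeight (hno : NonOverlapping t) (h0 : t.head? = some 0)
    (ht : 2 ≤ t.length) (hw : w.Nodup) :
    conv (chainWeight z t) (nmWeight z t) w = (if w = [] then 1 else 0) - nmWeight z t w := by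
  induction w using chainWeight.induct t with
  | case1 => simp [conv_nil, chainWeight, nmWeight]
  | case2 c =>
    have hmatch : ¬ HasMatch t [c] := not_hasMatch_of_length_lt ht
    simp [conv_cons, conv_nil, chainWeight, nmWeight, wordDes, hmatch]
  | case3 c d w ih ih' =>
    have hcd : c ≠ d := by simp_all
    rw [conv_chainWeight_cons_cons ht, ih hw.of_cons,
      ih' (hw.of_cons.sublist (List.drop_sublist _ _))]
    by_cases h : HeadMatch t (c :: d :: w)
    · rw [h.nmWeight_eq_zero, h.nmWeight_tail hno h0 ht hw]
      simp only [h, h.lt h0 ht hcd, h.drop_ne_nil, if_true, if_false,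
        reduceCtorEq]
      ring
    · rw [nmWeight_cons_cons hcd h]
      simp only [h, if_false, reduceCtorEq]
      split_ifs <;> ring

end Weights

section ExponentialGeneratingFunctions

theorem qInt_succ_ne_zero (n : ℕ) : qInt (n + 1) ≠ 0 := by
  have hsum : qInt (n + 1) = algebraMap (MvPolynomial (Fin 2) ℚ) K
      (∑ i ∈ range (n + 1), MvPolynomial.X 0 ^ i) := by
    simp only [qInt, q, map_sum, map_pow]
  intro h
  rw [hsum, IsFractionRing.to_map_eq_zero_iff] at h
  have heval := congrArg (MvPolynomial.eval fun _ => (1 : ℚ)) h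
  simp only [map_sum, map_pow, MvPolynomial.eval_X, one_pow, sum_const, card_range, map_zero,
    nsmul_eq_mul, mul_one] at heval
  exact Nat.cast_ne_zero.2 n.succ_ne_zero heval

theorem qFactorial_ne_zero (n : ℕ) : qFactorial n ≠ 0 :=
  prod_ne_zero_iff.2 fun i _ => qInt_succ_ne_zero i

theorem orderInvariant_const {M : Type*} (a : M) : OrderInvariant fun _ => a :=
  fun _ _ _ => rfl

theorem invSum_one (S : Finset ℕ) : invSum q S (fun _ => 1) = qFactorial #S := by
  rw [invSum_eq_invSum_range S (orderInvariant_const 1)]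
  induction #S with
  | zero => rw [range_zero, invSum_empty, qFactorial, prod_range_zero]
  | succ n ih =>
    rw [invSum_eq_sum_cons nonempty_range_add_one, qFactorial, prod_range_succ, ← qFactorial,
      qInt, mul_sum]
    refine sum_congr rfl fun x hx => ?_
    rw [invSum_eq_invSum_range _ (orderInvariant_const 1), card_erase_of_mem hx, card_range,
      Nat.add_sub_cancel, ih, rank_range (mem_range.1 hx).le, mul_comm]

theorem sum_crossInv (S : Finset ℕ) (k : ℕ) :
    ∑ C ∈ powersetCard k S, q ^ crossInv C (S \ C) = qBinom #S k := by
  rw [qBinom]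
  split_ifs with hk
  · rw [eq_div_iff (mul_ne_zero (qFactorial_ne_zero _) (qFactorial_ne_zero _)), sum_mul,
      ← invSum_one S, invSum_split hk fun _ _ => 1]
    refine sum_congr rfl fun C hC => ?_
    obtain ⟨hCS, hcard⟩ := mem_powersetCard.1 hC
    rw [invSum_one, card_sdiff_of_subset hCS, hcard, ← mul_one (qFactorial (#S - k)),
      invSum_const_mul, invSum_one, hcard]
    ring
  · rw [powersetCard_eq_empty.2 (not_le.1 hk), sum_empty]

theorem invSum_take_mul_drop {f g : List ℕ → K} (hf : OrderInvariant f) (hg : OrderInvariant g)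
    {n k : ℕ} (hk : k ≤ n) :
    invSum q (range n) (fun w => f (w.take k) * g (w.drop k)) =
      qBinom n k * (invSum q (range k) f * invSum q (range (n - k)) g) := by
  rw [invSum_split (by rwa [card_range]) fun x y => f x * g y, ← card_range n, ← sum_crossInv,
    sum_mul, card_range]
  refine sum_congr rfl fun C hC => ?_
  obtain ⟨hCn, hcard⟩ := mem_powersetCard.1 hC
  simp only [invSum_const_mul, invSum_mul_const]
  rw [invSum_eq_invSum_range C hf, invSum_eq_invSum_range _ hg, card_sdiff_of_subset hCn, hcard,
    card_range]

/-- The `q`-exponential generating function `∑ₙ tⁿ / [n]_q! ∑_w q ^ inv w * f w`, where `w` runs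
over the arrangements of `{0, …, n - 1}`. -/
noncomputable def egf (f : List ℕ → K) : PowerSeries K :=
  PowerSeries.mk fun n => invSum q (range n) f / qFactorial n

theorem egf_mul {f g : List ℕ → K} (hf : OrderInvariant f) (hg : OrderInvariant g) :
    egf f * egf g = egf (conv f g) := by
  ext n
  have hconv : invSum q (range n) (conv f g) =
      ∑ k ∈ range (n + 1), invSum q (range n) fun w => f (w.take k) * g (w.drop k) := by
    simp only [invSum, sum_comm (s := range (n + 1)), ← mul_sum]
    refine sum_congr rfl fun w hw => ?_
    rw [conv, length_of_mem_arrangements hw, card_range]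
  simp only [egf, PowerSeries.coeff_mul, PowerSeries.coeff_mk]
  rw [Nat.sum_antidiagonal_eq_sum_range_succ fun i j =>
    invSum q (range i) f / qFactorial i * (invSum q (range j) g / qFactorial j), hconv, sum_div]
  refine sum_congr rfl fun k hk => ?_
  have hkn : k ≤ n := Nat.lt_succ_iff.1 (mem_range.1 hk)
  rw [invSum_take_mul_drop hf hg hkn, qBinom, if_pos hkn]
  field_simp [qFactorial_ne_zero]

theorem egf_indicator_nil : egf (fun w => if w = [] then 1 else 0) = 1 := by
  ext n
  rw [egf, PowerSeries.coeff_mk, PowerSeries.coeff_one]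
  split_ifs with hn
  · rw [hn, range_zero, invSum_empty, qFactorial, prod_range_zero, if_pos rfl, div_one]
  · rw [invSum_eq_zero fun w hw => if_neg ?_, zero_div]
    rintro rfl
    exact hn (by simpa using (length_of_mem_arrangements hw).symm)

theorem egf_chainWeight_mul {t : List ℕ} (hno : NonOverlapping t) (h0 : t.head? = some 0)
    (ht : 2 ≤ t.length) :
    egf (chainWeight z t) * egf (nmWeight z t) = 1 - egf (nmWeight z t) := by
  rw [egf_mul orderInvariant_chainWeight orderInvariant_nmWeight, ← egf_indicator_nil]
  ext n
  simp only [egf, map_sub, PowerSeries.coeff_mk]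
  rw [invSum_congr fun w hw =>
    conv_chainWeight_nmWeight hno h0 ht (nodup_of_mem_arrangements hw), invSum_sub, sub_div]

end ExponentialGeneratingFunctions

section FirstLetters

variable {R : Type*} [CommRing R] {q z : R} {t : List ℕ} {c x : ℕ} {y : List ℕ}

theorem HeadMatch.exists_drop_eq_cons (h : HeadMatch t (c :: y)) (h0 : t.head? = some 0)
    (ht : 2 ≤ t.length) (hx : x ∈ y) (hxc : x < c) :
    ∃ l v, y.drop (t.length - 2) = l :: v ∧ x ∈ v ∧ x < l := by
  have hmin := h.head_le h0
  rw [show t.length - 1 = t.length - 2 + 1 by omega] at hmin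
  have hxv : x ∈ y.drop (t.length - 2) := by
    rw [← List.take_append_drop (t.length - 2) y] at hx
    refine (List.mem_append.1 hx).resolve_left fun hx' => hxc.not_ge (hmin x ?_)
    exact (List.take_sublist_take_left (Nat.le_succ _)).mem hx'
  obtain ⟨l, v, hlv⟩ := List.exists_cons_of_ne_nil (List.ne_nil_of_mem hxv)
  have hcl : c ≤ l := hmin l <| by
    rw [List.take_add_one, List.mem_append]
    right
    rw [← List.head?_drop, hlv]
    exact List.mem_singleton_self l
  rw [hlv] at hxv
  exact ⟨l, v, hlv, (List.mem_cons.1 hxv).resolve_left (by omega), by omega⟩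

theorem chainWeight_cons_eq_zero (h0 : t.head? = some 0) (ht : 2 ≤ t.length) (hx : x ∈ y)
    (hxc : x < c) : chainWeight z t (c :: y) = 0 := by
  suffices ∀ w c y, w = c :: y → x ∈ y → x < c → chainWeight z t w = 0 from this _ c y rfl hx hxc
  intro w
  induction w using chainWeight.induct t with
  | case1 => simp
  | case2 c => simp
  | case3 c d w ih ih' =>
    rintro _ _ ⟨⟩ hx hxc
    have hascent : c < d → chainWeight z t (d :: w) = 0 := fun hcd =>
      ih d w rfl ((List.mem_cons.1 hx).resolve_left (by omega)) (hxc.trans hcd)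
    have hmatch : HeadMatch t (c :: d :: w) →
        chainWeight z t ((d :: w).drop (t.length - 2)) = 0 := fun h =>
      have ⟨l, v, hlv, hxv, hxl⟩ := h.exists_drop_eq_cons h0 ht hx hxc
      ih' l v hlv hxv hxl
    simp +contextual [chainWeight, hascent, hmatch]

theorem invSum_insert_of_lt {S : Finset ℕ} {f : List ℕ → R} (hS : ∀ x ∈ S, c < x)
    (hf : ∀ x y, c ∈ y → c < x → f (x :: y) = 0) :
    invSum q (insert c S) f = invSum q S fun y => f (c :: y) := by
  have hc : c ∉ S := fun h => lt_irrefl c (hS c h)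
  have hrank : rank (insert c S) c = 0 := by
    simp only [rank, card_eq_zero, filter_eq_empty_iff, mem_insert, forall_eq_or_imp]
    exact ⟨lt_irrefl c, fun x hx => (hS x hx).not_gt⟩
  rw [invSum_eq_sum_cons (insert_nonempty c S), sum_insert hc, hrank, pow_zero, one_mul,
    erase_insert hc, add_eq_left]
  refine sum_eq_zero fun x hx => ?_
  rw [invSum_eq_zero fun y hy => hf x y ?_ (hS x hx), mul_zero]
  exact (mem_iff_of_mem_arrangements hy).2
    (mem_erase.2 ⟨(hS x hx).ne, mem_insert_self c S⟩)

theorem invSum_chainWeight_cons (h0 : t.head? = some 0) (ht : 2 ≤ t.length) {S : Finset ℕ}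
    (hc : c ∉ S) :
    invSum q S (fun y => chainWeight z t (c :: y)) =
      if ∀ x ∈ S, c < x then invSum q (range (#S + 1)) (chainWeight z t) else 0 := by
  split_ifs with hS
  · rw [← card_insert_of_notMem hc, ← invSum_eq_invSum_range _ orderInvariant_chainWeight,
      invSum_insert_of_lt hS fun _ _ => chainWeight_cons_eq_zero h0 ht]
  · push Not at hS
    obtain ⟨x, hxS, hxc⟩ := hS
    exact invSum_eq_zero fun y hy => chainWeight_cons_eq_zero h0 ht
      ((mem_iff_of_mem_arrangements hy).2 hxS) (hxc.lt_of_ne (ne_of_mem_of_not_mem hxS hc))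

theorem invSum_chainWeight_range_succ (h0 : t.head? = some 0) (ht : 2 ≤ t.length) {n : ℕ}
    (hn : 1 ≤ n) :
    invSum q (range (n + 1)) (chainWeight z t) =
      (1 - z) * invSum q (range n) (chainWeight z t) -
        z ^ wordDes t * invSum q (range (n + 1)) fun w =>
          if HeadMatch t w then chainWeight z t (w.drop (t.length - 1)) else 0 := by
  have hpos : ∀ x ∈ (range (n + 1)).erase 0, 0 < x := fun x hx =>
    Nat.pos_of_ne_zero (mem_erase.1 hx).1
  have hcard : #((range (n + 1)).erase 0) = n := by simp
  have hrelabel : invSum q (range n) (chainWeight z t) =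
      invSum q ((range (n + 1)).erase 0) (chainWeight z t) := by
    rw [invSum_eq_invSum_range ((range (n + 1)).erase 0) orderInvariant_chainWeight, hcard]
  have hdrop : ∀ (c : ℕ) y, (c :: y).drop (t.length - 1) = y.drop (t.length - 2) := fun c y => by
    rw [show t.length - 1 = t.length - 2 + 1 by omega, List.drop_succ_cons]
  have hrange : insert 0 ((range (n + 1)).erase 0) = range (n + 1) := insert_erase (by simp)
  rw [← hrange, invSum_insert_of_lt hpos fun _ _ => chainWeight_cons_eq_zero h0 ht,
    invSum_insert_of_lt hpos, hrelabel, ← invSum_const_mul, ← invSum_const_mul, ← invSum_sub]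
  · refine invSum_congr fun y hy => ?_
    obtain ⟨d, w, rfl⟩ := List.exists_cons_of_length_pos
      (hn.trans_eq ((length_of_mem_arrangements hy).trans hcard).symm)
    have hd : 0 < d := hpos d ((mem_iff_of_mem_arrangements hy).1 List.mem_cons_self)
    rw [chainWeight, if_pos hd, hdrop]
    split_ifs <;> ring
  · intro x y hy hx
    split_ifs with h
    · obtain ⟨l, v, hlv, hv, hl⟩ := h.exists_drop_eq_cons h0 ht hy hx
      rw [hdrop, hlv, chainWeight_cons_eq_zero h0 ht hv hl]
    · rfl

end FirstLetters

section FirstOccurrence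

variable {R : Type*} [CommRing R] {q z : R} {t : List ℕ} {S : Finset ℕ}

theorem invSum_headMatch (ht : t ∈ arrangements (range t.length)) (hS : #S = t.length) :
    invSum q S (fun x => if HeadMatch t x then 1 else 0) = q ^ wordInv t := by
  have hinv : OrderInvariant fun x => if HeadMatch t x then (1 : R) else 0 := fun w φ hφ =>
    if_congr (iff_of_eq (orderInvariant_headMatch t hφ)) rfl rfl
  have hmatch : ∀ w ∈ arrangements (range t.length), (HeadMatch t w ↔ w = t) := fun w hw => by
    have hlength := (length_of_mem_arrangements hw).trans (card_range _)
    rw [HeadMatch, List.take_of_length_le hlength.le, reduction_of_mem_arrangements_range hw]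
  rw [invSum_eq_invSum_range S hinv, hS, invSum,
    sum_eq_single_of_mem t ht fun w hw hwt => by rw [if_neg (mt (hmatch w hw).1 hwt), mul_zero],
    if_pos ((hmatch t ht).2 rfl), mul_one]

theorem HeadMatch.exists_drop_eq_singleton {m : ℕ} {x : List ℕ} (h : HeadMatch t x)
    (hx : x ∈ arrangements S) (hS : #S = t.length) (hm : t.getLast? = some m) :
    ∃ l ∈ S, x.drop (t.length - 1) = [l] ∧ rank S l = m := by
  have hlength := (length_of_mem_arrangements hx).trans hS
  rw [HeadMatch, List.take_of_length_le hlength.le, reduction_eq_map_rank hx] at h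
  rw [← h, List.getLast?_map, Option.map_eq_some_iff] at hm
  obtain ⟨l, hl, hrank⟩ := hm
  refine ⟨l, (mem_iff_of_mem_arrangements hx).1 (List.mem_of_getLast? hl), ?_, hrank⟩
  obtain ⟨u, rfl⟩ := List.getLast?_eq_some_iff.1 hl
  rw [← hlength, List.length_append, List.length_singleton, Nat.add_sub_cancel, List.drop_left]

theorem forall_lt_sdiff_iff_range_subset {n l : ℕ} {C : Finset ℕ} (hC : C ⊆ range n) (hl : l ∈ C) :
    (∀ x ∈ range n \ C, l < x) ↔ range (rank C l + 1) ⊆ C := by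
  constructor
  · intro h
    have hlt : range l ⊆ C := fun x hx => by
      by_contra hxC
      rw [mem_range] at hx
      exact (h x (mem_sdiff.2 ⟨mem_range.2 (hx.trans (mem_range.1 (hC hl))), hxC⟩)).not_gt hx
    have hrank : rank C l = l := by
      rw [rank, show {y ∈ C | y < l} = range l by grind, card_range]
    rw [hrank, range_add_one, insert_subset_iff]
    exact ⟨hl, hlt⟩
  · intro h x hx
    by_contra! hxl
    have hrank : rank C l < x := by
      by_contra! hle
      exact (mem_sdiff.1 hx).2 (h (mem_range.2 (Nat.lt_succ_of_le hle)))
    have hsubset : range (rank C l + 1) ⊆ {y ∈ C | y < l} := by grind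
    exact (card_le_card hsubset).not_gt (by rw [card_range]; exact Nat.lt_succ_self _)

theorem crossInv_union_sdiff {A B : Finset ℕ} (hA : ∀ a ∈ A, ∀ b ∈ S \ A, a < b)
    (hB : Disjoint A B) :
    crossInv (A ∪ B) (S \ (A ∪ B)) = crossInv B ((S \ A) \ B) := by
  have hzero : ∀ a ∈ A, rank ((S \ A) \ B) a = 0 := fun a ha => by
    simp only [rank, card_eq_zero, filter_eq_empty_iff]
    exact fun b hb => (hA a ha b (mem_sdiff.1 hb).1).not_gt
  have hsdiff : S \ (A ∪ B) = (S \ A) \ B := sdiff_sdiff_left.symm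
  rw [crossInv, sum_union hB, hsdiff, sum_eq_zero hzero, zero_add, crossInv]

theorem sum_crossInv_of_subset {A : Finset ℕ} {k : ℕ} (hAS : A ⊆ S)
    (hA : ∀ a ∈ A, ∀ b ∈ S \ A, a < b) (hk : #A ≤ k) :
    ∑ C ∈ powersetCard k S with A ⊆ C, q ^ crossInv C (S \ C) =
      ∑ B ∈ powersetCard (k - #A) (S \ A), q ^ crossInv B ((S \ A) \ B) := by
  have hdisjoint : ∀ B ∈ powersetCard (k - #A) (S \ A), Disjoint A B := fun B hB =>
    disjoint_sdiff.mono_right (mem_powersetCard.1 hB).1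
  refine (sum_nbij' (A ∪ ·) (· \ A) (fun B hB => ?_) (fun C hC => ?_) (fun B hB => ?_)
    (fun C hC => ?_) (fun B hB => ?_)).symm
  · obtain ⟨hBS, hcard⟩ := mem_powersetCard.1 hB
    rw [mem_filter, mem_powersetCard, card_union_of_disjoint (hdisjoint B hB), hcard]
    exact ⟨⟨union_subset hAS (hBS.trans sdiff_subset), Nat.add_sub_cancel' hk⟩,
      subset_union_left⟩
  · obtain ⟨hC, hAC⟩ := mem_filter.1 hC
    obtain ⟨hCS, hcard⟩ := mem_powersetCard.1 hC
    rw [mem_powersetCard, card_sdiff_of_subset hAC, hcard]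
    exact ⟨sdiff_subset_sdiff hCS subset_rfl, rfl⟩
  · exact union_sdiff_cancel_left (hdisjoint B hB)
  · exact union_sdiff_of_subset (mem_filter.1 hC).2
  · rw [crossInv_union_sdiff hA (hdisjoint B hB)]

end FirstOccurrence

section Recursion

variable {z : K} {t : List ℕ} {m n : ℕ}

theorem sum_crossInv_range_subset {k : ℕ} (hk : m ≤ k) (hn : k ≤ n) :
    ∑ C ∈ powersetCard k (range n) with range m ⊆ C, q ^ crossInv C (range n \ C) =
      qBinom (n - m) (k - m) := by
  have hmn : range m ⊆ range n := range_subset_range.2 (hk.trans hn)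
  have hcard : #(range n \ range m) = n - m := by
    rw [card_sdiff_of_subset hmn, card_range, card_range]
  rw [sum_crossInv_of_subset hmn (fun a ha b hb => ?_) ((card_range m).trans_le hk), card_range,
    sum_crossInv, hcard]
  exact (mem_range.1 ha).trans_le (not_lt.1 (mt mem_range.2 (mem_sdiff.1 hb).2))

theorem invSum_headMatch_mul_chainWeight (h0 : t.head? = some 0) (ht : 2 ≤ t.length)
    (hperm : t ∈ arrangements (range t.length)) (hm : t.getLast? = some m) {C : Finset ℕ}
    (hC : C ∈ powersetCard t.length (range n)) :
    invSum q C (fun x => invSum q (range n \ C) fun y =>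
        if HeadMatch t x then chainWeight z t (x.drop (t.length - 1) ++ y) else 0) =
      if range (m + 1) ⊆ C then
        q ^ wordInv t * invSum q (range (n - t.length + 1)) (chainWeight z t) else 0 := by
  obtain ⟨hCn, hcard⟩ := mem_powersetCard.1 hC
  have hinner : ∀ x ∈ arrangements C, (invSum q (range n \ C) fun y =>
      if HeadMatch t x then chainWeight z t (x.drop (t.length - 1) ++ y) else 0) =
      (if HeadMatch t x then 1 else 0) * if range (m + 1) ⊆ C then
        invSum q (range (n - t.length + 1)) (chainWeight z t) else 0 := by
    intro x hx
    by_cases h : HeadMatch t x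
    · obtain ⟨l, hl, hdrop, rfl⟩ := h.exists_drop_eq_singleton hx hcard hm
      have hlC : l ∉ range n \ C := fun h => (mem_sdiff.1 h).2 hl
      simp only [h, if_true, one_mul, hdrop, List.singleton_append]
      rw [invSum_chainWeight_cons h0 ht hlC, card_sdiff_of_subset hCn, card_range, hcard]
      exact if_congr (forall_lt_sdiff_iff_range_subset hCn hl) rfl rfl
    · rw [if_neg h, zero_mul]
      exact invSum_eq_zero fun _ _ => if_neg h
  rw [invSum_congr hinner, invSum_mul_const, invSum_headMatch hperm hcard, mul_ite_zero]

theorem invSum_chainWeight_drop_of_headMatch (h0 : t.head? = some 0)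
    (hperm : t ∈ arrangements (range t.length)) (hm : t.getLast? = some m)
    (hmt : m + 1 < t.length) (n : ℕ) :
    (invSum q (range n) fun w =>
      if HeadMatch t w then chainWeight z t (w.drop (t.length - 1)) else 0) =
      q ^ wordInv t * qBinom (n - (m + 1)) (t.length - (m + 1)) *
        invSum q (range (n - t.length + 1)) (chainWeight z t) := by
  have ht : 2 ≤ t.length := by omega
  by_cases hn : t.length ≤ n
  · have hsplit : ∀ w : List ℕ,
        (if HeadMatch t w then chainWeight z t (w.drop (t.length - 1)) else 0) =
          if HeadMatch t (w.take t.length) then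
            chainWeight z t ((w.take t.length).drop (t.length - 1) ++ w.drop t.length) else 0 := by
      intro w
      have hdrop : (w.take t.length).drop (t.length - 1) ++ w.drop t.length =
          w.drop (t.length - 1) := by
        rw [List.drop_take, Nat.sub_sub_self (by omega)]
        conv_rhs => rw [← List.take_append_drop 1 (w.drop _), List.drop_drop,
          Nat.sub_add_cancel (by omega)]
      simp only [headMatch_take_iff, le_refl, true_and, hdrop]
    rw [invSum_congr fun w _ => hsplit w, invSum_split (by rwa [card_range]) fun x y =>
        if HeadMatch t x then chainWeight z t (x.drop (t.length - 1) ++ y) else 0,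
      ← sum_crossInv_range_subset hmt.le hn, sum_filter, mul_sum, sum_mul]
    refine sum_congr rfl fun C hC => ?_
    rw [invSum_headMatch_mul_chainWeight h0 ht hperm hm hC]
    split_ifs <;> ring
  · rw [qBinom, if_neg (by omega), mul_zero, zero_mul]
    refine invSum_eq_zero fun w hw => if_neg fun h => hn ?_
    simpa only [length_of_mem_arrangements hw, card_range] using h.length_le

theorem invSum_chainWeight_recursion (h0 : t.head? = some 0)
    (hperm : t ∈ arrangements (range t.length)) (hm : t.getLast? = some m)
    (hmt : m + 1 < t.length) (hn : 2 ≤ n) :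
    invSum q (range n) (chainWeight z t) =
      (1 - z) * invSum q (range (n - 1)) (chainWeight z t) -
        z ^ wordDes t * q ^ wordInv t * qBinom (n - (m + 1)) (t.length - (m + 1)) *
          invSum q (range (n - t.length + 1)) (chainWeight z t) := by
  obtain ⟨n, rfl⟩ := Nat.exists_eq_add_of_le' (one_le_two.trans hn)
  rw [invSum_chainWeight_range_succ h0 (by omega) (Nat.le_of_succ_le_succ hn),
    invSum_chainWeight_drop_of_headMatch h0 hperm hm hmt, Nat.add_sub_cancel]
  ring

end Recursion

section Permutations

variable {n p : ℕ}

/-- The one-line notation of a permutation, as a word in the letters `0, …, n - 1`. -/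
def toWord (σ : Equiv.Perm (Fin n)) : List ℕ := List.ofFn fun i => (σ i : ℕ)

theorem length_toWord (σ : Equiv.Perm (Fin n)) : (toWord σ).length = n := List.length_ofFn

theorem head?_toWord (hn : 0 < n) (σ : Equiv.Perm (Fin n)) :
    (toWord σ).head? = some (σ ⟨0, hn⟩ : ℕ) := by
  simp [toWord, List.head?_eq_getElem?, hn]

theorem getLast?_toWord (hn : n - 1 < n) (σ : Equiv.Perm (Fin n)) :
    (toWord σ).getLast? = some (σ ⟨n - 1, hn⟩ : ℕ) := by
  simp [toWord, List.getLast?_eq_getElem?, hn]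

theorem toWord_injective : Function.Injective (toWord (n := n)) := fun _ _ h =>
  Equiv.ext fun i => Fin.ext (congrFun (List.ofFn_injective h) i)

theorem toWord_mem_arrangements (σ : Equiv.Perm (Fin n)) : toWord σ ∈ arrangements (range n) := by
  have hnodup : (toWord σ).Nodup := List.nodup_ofFn.2 (Fin.val_injective.comp σ.injective)
  have hsubset : (toWord σ).toFinset ⊆ range n := fun x hx => by
    obtain ⟨i, rfl⟩ := (List.mem_ofFn' _ _).1 (List.mem_toFinset.1 hx)
    exact mem_range.2 (σ i).isLt
  rw [← eq_of_subset_of_card_le hsubset]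
  · exact mem_arrangements_toFinset hnodup
  · rw [List.toFinset_card_of_nodup hnodup, length_toWord, card_range]

theorem image_toWord : univ.image (toWord (n := n)) = arrangements (range n) := by
  refine eq_of_subset_of_card_le (image_subset_iff.2 fun σ _ => toWord_mem_arrangements σ) ?_
  rw [card_arrangements, card_image_of_injective _ toWord_injective, card_univ,
    Fintype.card_perm, Fintype.card_fin, card_range]

theorem countP_ofFn {α : Type*} (f : Fin n → α) (P : α → Prop) [DecidablePred P] :
    (List.ofFn f).countP P = #{i | P (f i)} := by
  induction n with
  | zero => rfl
  | succ n ih =>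
    rw [List.ofFn_succ, List.countP_cons, ih, Fin.card_filter_univ_succ]
    split_ifs <;> simp_all [add_comm]

theorem wordInv_ofFn {α : Type*} [LinearOrder α] (f : Fin n → α) :
    wordInv (List.ofFn f) = #{x : Fin n × Fin n | x.1 < x.2 ∧ f x.2 < f x.1} := by
  induction n with
  | zero => rfl
  | succ n ih =>
    rw [List.ofFn_succ, wordInv, ih, countP_ofFn]
    simp only [card_filter, Fintype.sum_prod_type, Fin.sum_univ_succ]
    simp

theorem wordDes_ofFn {α : Type*} [LinearOrder α] (f : Fin n → α) :
    wordDes (List.ofFn f) = #{i : Fin n | ∃ h : (i : ℕ) + 1 < n, f ⟨i + 1, h⟩ < f i} := by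
  induction n with
  | zero => rfl
  | succ n ih =>
    cases n with
    | zero => exact (card_eq_zero.2 (filter_eq_empty_iff.2 fun i _ ⟨h, _⟩ => by omega)).symm
    | succ n =>
      have htail := ih fun i => f i.succ
      rw [List.ofFn_succ] at htail
      rw [List.ofFn_succ, List.ofFn_succ, wordDes, Fin.card_filter_univ_succ', htail]
      exact congrArg₂ (· + ·) (if_congr (by simp) rfl rfl) (by simp)

theorem inv_eq_wordInv (σ : Equiv.Perm (Fin n)) : inv σ = wordInv (toWord σ) := by
  simp only [toWord, wordInv_ofFn, inv, Fin.lt_def]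

theorem des_eq_wordDes (σ : Equiv.Perm (Fin n)) : des σ = wordDes (toWord σ) := by
  simp only [toWord, wordDes_ofFn, des, Fin.lt_def]

theorem reduction_ofFn (f : Fin n → ℕ) : reduction (List.ofFn f) = List.ofFn (red f) := by
  simp only [reduction, List.map_ofFn, Function.comp_def, countP_ofFn]
  rfl

theorem isMatchAt_iff (hp : 0 < p) {τ : Equiv.Perm (Fin p)} {σ : Equiv.Perm (Fin n)} {i : ℕ} :
    IsMatchAt τ σ i ↔ HeadMatch (toWord τ) ((toWord σ).drop i) := by
  have hiff : ∀ h : i + p ≤ n, HeadMatch (toWord τ) ((toWord σ).drop i) ↔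
      ∀ a : Fin p, red (fun b : Fin p => (σ ⟨i + (b : ℕ), by omega⟩ : ℕ)) a = (τ a : ℕ) := by
    intro h
    have hfactor : ((toWord σ).drop i).take p =
        List.ofFn fun b : Fin p => (σ ⟨i + (b : ℕ), by omega⟩ : ℕ) := by
      refine List.ext_getElem ?_ fun j hj hj' => ?_
      · simp only [List.length_take, List.length_drop, length_toWord, List.length_ofFn]
        omega
      · simp [toWord]
    rw [HeadMatch, length_toWord, hfactor, reduction_ofFn, toWord, List.ofFn_injective.eq_iff,
      funext_iff]
  refine ⟨fun ⟨h, hred⟩ => (hiff h).2 hred, fun h => ?_⟩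
  have hlength := h.length_le
  rw [List.length_drop, length_toWord, length_toWord] at hlength
  exact ⟨by omega, (hiff (by omega)).1 h⟩

theorem mch_eq_two_of_headMatch {τ : Equiv.Perm (Fin p)} (hp : 0 < p) {w : List ℕ} {d : ℕ}
    (hw : w.Nodup) (hd : 0 < d) (h : HeadMatch (toWord τ) w)
    (hmatch : ∀ i ≤ d, 0 < i → (HeadMatch (toWord τ) (w.drop i) ↔ i = d)) :
    ∃ σ : Equiv.Perm (Fin (d + p)), mch τ σ = 2 := by
  have hlength : d + p ≤ w.length := by
    have hle := ((hmatch d le_rfl hd).2 rfl).length_le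
    rw [List.length_drop, length_toWord] at hle
    omega
  have hfactor := mem_arrangements_toFinset (hw.sublist (w.take_sublist (d + p)))
  have hred := reduction_mem_arrangements hfactor
  rw [← length_of_mem_arrangements hfactor, List.length_take, min_eq_left hlength,
    ← image_toWord] at hred
  obtain ⟨σ, -, hσ⟩ := mem_image.1 hred
  have hiff : ∀ i, IsMatchAt τ σ i ↔ i ≤ d ∧ HeadMatch (toWord τ) (w.drop i) := fun i => by
    have hinv : OrderInvariant fun v => HeadMatch (toWord τ) (v.drop i) := fun v φ hφ => by
      simp only [← List.map_drop]
      exact orderInvariant_headMatch _ (hφ.mono fun _ => List.mem_of_mem_drop)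
    rw [isMatchAt_iff hp, hσ, hinv.apply_reduction hfactor, List.drop_take, headMatch_take_iff,
      length_toWord]
    exact and_congr_left fun _ => by omega
  refine ⟨σ, ?_⟩
  rw [mch, ← card_pair hd.ne]
  congr 1
  ext i
  simp only [mem_filter, mem_range, hiff, mem_insert, mem_singleton]
  rcases i.eq_zero_or_pos with rfl | hi
  · simpa using h
  · grind

theorem IsMinimalOverlapping.nonOverlapping {τ : Equiv.Perm (Fin p)}
    (hτ : IsMinimalOverlapping τ) : NonOverlapping (toWord τ) := by
  intro w d
  rw [length_toWord]
  induction d using Nat.strong_induction_on with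
  | _ d ih =>
    intro hw hd h hhd
    by_contra! hlt
    have hmatch : ∀ i ≤ d, 0 < i → (HeadMatch (toWord τ) (w.drop i) ↔ i = d) := by
      refine fun i hi hi0 => ⟨fun h' => ?_, fun h' => h' ▸ hhd⟩
      by_contra hne
      have := ih i (by omega) hw hi0 h h'
      omega
    have hp := hτ.1
    have hle := hτ.2.2 (mch_eq_two_of_headMatch (by omega) hw hd h hmatch)
    omega

theorem INMcoeff_eq_invSum (hp : 0 < p) (τ : Equiv.Perm (Fin p)) (hn : n ≠ 0) :
    INMcoeff τ n = invSum q (range n) (nmWeight z (toWord τ)) := by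
  rw [invSum, ← image_toWord, sum_image toWord_injective.injOn, INMcoeff, NM, sum_filter]
  refine sum_congr rfl fun σ _ => ?_
  have hne : toWord σ ≠ [] := List.ne_nil_of_length_pos (by rw [length_toWord]; omega)
  have havoid : (∀ i ≤ n, ¬ IsMatchAt τ σ i) ↔ ¬ HasMatch (toWord τ) (toWord σ) := by
    simp only [isMatchAt_iff hp, HasMatch, not_exists]
    refine ⟨fun h i hi => h i ?_ hi, fun h i _ => h i⟩
    have hlength := hi.length_le
    rw [List.length_drop, length_toWord, length_toWord] at hlength
    omega
  rw [if_congr havoid rfl rfl, nmWeight, if_neg hne, des_eq_wordDes, inv_eq_wordInv]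
  split_ifs <;> ring

theorem INM_eq_egf (hp : 0 < p) (τ : Equiv.Perm (Fin p)) :
    INM τ = egf (nmWeight z (toWord τ)) := by
  ext n
  rw [INM, egf, PowerSeries.coeff_mk, PowerSeries.coeff_mk]
  split_ifs with hn
  · rw [hn, range_zero, invSum_empty, nmWeight, if_pos rfl, qFactorial, prod_range_zero, div_one]
  · rw [INMcoeff_eq_invSum hp τ hn]

theorem constantCoeff_INM (τ : Equiv.Perm (Fin p)) : PowerSeries.constantCoeff (INM τ) = 1 := by
  rw [INM, PowerSeries.constantCoeff_mk, if_pos rfl]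

theorem INM_mul_IU (τ : Equiv.Perm (Fin p)) : INM τ * IU τ = 1 :=
  PowerSeries.mul_inv_cancel _ (by rw [constantCoeff_INM]; exact one_ne_zero)

theorem constantCoeff_IU (τ : Equiv.Perm (Fin p)) : PowerSeries.constantCoeff (IU τ) = 1 := by
  rw [IU, PowerSeries.constantCoeff_inv, constantCoeff_INM, inv_one]

theorem INM_eq_inv_IU (τ : Equiv.Perm (Fin p)) : INM τ = (IU τ)⁻¹ :=
  (PowerSeries.eq_inv_iff_mul_eq_one (by rw [constantCoeff_IU]; exact one_ne_zero)).2 (INM_mul_IU τ)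

theorem IU_eq_mk (τ : Equiv.Perm (Fin p)) :
    IU τ = PowerSeries.mk fun n => if n = 0 then 1 else IUcoeff τ n / qFactorial n := by
  ext n
  rw [PowerSeries.coeff_mk]
  split_ifs with hn
  · rw [hn, PowerSeries.coeff_zero_eq_constantCoeff_apply, constantCoeff_IU]
  · rw [IUcoeff, mul_div_cancel_left₀ _ (qFactorial_ne_zero n)]

theorem IsMinimalOverlapping.IU_eq_one_add_egf {τ : Equiv.Perm (Fin p)}
    (hτ : IsMinimalOverlapping τ) (h0 : (toWord τ).head? = some 0) :
    IU τ = 1 + egf (chainWeight z (toWord τ)) := by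
  have hp := hτ.1
  have hmul := egf_chainWeight_mul hτ.nonOverlapping h0 (by rw [length_toWord]; omega)
  rw [← INM_eq_egf (by omega)] at hmul
  rw [IU, PowerSeries.inv_eq_iff_mul_eq_one (by rw [constantCoeff_INM]; exact one_ne_zero),
    add_mul, one_mul, hmul, add_sub_cancel]

theorem IsMinimalOverlapping.IUcoeff_eq_invSum {τ : Equiv.Perm (Fin p)}
    (hτ : IsMinimalOverlapping τ) (h0 : (toWord τ).head? = some 0) (hn : n ≠ 0) :
    IUcoeff τ n = invSum q (range n) (chainWeight z (toWord τ)) := by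
  rw [IUcoeff, hτ.IU_eq_one_add_egf h0, map_add, PowerSeries.coeff_one, if_neg hn, zero_add, egf,
    PowerSeries.coeff_mk, mul_div_cancel₀ _ (qFactorial_ne_zero n)]

end Permutations

end MinOverlap

open MinOverlap

/-- In the recursion, the subtractions in `ℕ` do no harm: for `n < p` the `q`-binomial coefficient
`qBinom (n - s) (p - s)` is `0`, and for `n ≥ p` all the differences are the true ones. -/
theorem theorem4p1 (p s : ℕ) (hs : 2 ≤ s) (hsp : s < p) (τ : Equiv.Perm (Fin p))
    (hτ : MinOverlap.IsMinimalOverlapping τ)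
    (hfirst : (τ ⟨0, Nat.zero_lt_of_lt hsp⟩ : ℕ) + 1 = 1)
    (hlast : (τ ⟨p - 1, Nat.sub_one_lt_of_lt hsp⟩ : ℕ) + 1 = s) :
    MinOverlap.INM τ * MinOverlap.IU τ = 1 ∧
    MinOverlap.INM τ = (MinOverlap.IU τ)⁻¹ ∧
    MinOverlap.IU τ = PowerSeries.mk (fun n =>
      if n = 0 then 1 else MinOverlap.IUcoeff τ n / MinOverlap.qFactorial n) ∧
    MinOverlap.IUcoeff τ 1 = -MinOverlap.z ∧
    ∀ n : ℕ, 2 ≤ n →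
      MinOverlap.IUcoeff τ n =
        (1 - MinOverlap.z) * MinOverlap.IUcoeff τ (n - 1)
          - MinOverlap.z ^ MinOverlap.des τ * MinOverlap.q ^ MinOverlap.inv τ
            * MinOverlap.qBinom (n - s) (p - s) * MinOverlap.IUcoeff τ (n - p + 1) := by
  have hp : 0 < p := Nat.zero_lt_of_lt hsp
  have h0 : (toWord τ).head? = some 0 := by
    rw [head?_toWord hp, Nat.add_eq_right.1 hfirst]
  have hlen : (toWord τ).length = p := length_toWord τ
  have hperm : toWord τ ∈ arrangements (Finset.range (toWord τ).length) :=
    hlen.symm ▸ toWord_mem_arrangements τ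
  have hrec := fun n hn => invSum_chainWeight_recursion (z := z) (n := n) h0 hperm
    (getLast?_toWord (Nat.sub_one_lt_of_lt hsp) τ) (by omega) hn
  simp only [hlast, hlen, ← des_eq_wordDes, ← inv_eq_wordInv] at hrec
  refine ⟨INM_mul_IU τ, INM_eq_inv_IU τ, IU_eq_mk τ, ?_, fun n hn => ?_⟩
  · rw [hτ.IUcoeff_eq_invSum h0 one_ne_zero, Finset.range_one, invSum_singleton, chainWeight]
  · rw [hτ.IUcoeff_eq_invSum h0 (by omega), hτ.IUcoeff_eq_invSum h0 (by omega),
      hτ.IUcoeff_eq_invSum h0 (by omega), hrec n hn]
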